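/- Let $n\ge 0$, $d\ge 1$ be integers, let $\tilde A\in\mathbb{R}^{n\times n}$ and let $(W^{(k)})_{k\ge 1}$ be an arbitrary sequence of matrices in $\mathbb{R}^{d\times d}$. For $X^{(0)}\in\mathbb{R}^{n\times d}$ put $X^{(k)}=\tilde A X^{(k-1)}W^{(k)}$ for $k\ge 1$. Let $m>0$ and let $X^{(0)}$ be uniformly distributed on the box $[-m,m]^{n\times d}$ (normalized Lebesgue measure). Write $\|\cdot\|_F$ for the Frobenius norm and $\widehat X^{(k)}=X^{(k)}/\|X^{(k)}\|_F$, with the convention $\widehat X^{(k)}=0$ if $X^{(k)}=0$. This convention matters only on a null set unless $\tilde A^k=0$ or $W^{(1)}\cdots W^{(k)}=0$: for every $k$ with $\tilde A^k\neq 0$ and $W^{(1)}\cdots W^{(k)}\ne 0$, one has $X^{(k)}\ne 0$ almost surely. (1) (Rank collapse in probability.) Let $\lambda_1,\dots,\lambda_n\in\mathbb{C}$ be the eigenvalues of $\tilde A$, listed with algebraic multiplicity, and suppose $|\lambda_1|>|\lambda_i|$ for all $i>1$ (in particular $n\ge 1$). Then $\tilde A$ has a real eigenvector for $\lambda_1$,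 and for every such eigenvector $u\in\mathbb{R}^n\setminus\{0\}$ there are vectors $n_{(k)}\in\mathbb{R}^d$, $k\ge 0$, which are measurable functions of $X^{(0)}$, such that all the matrices $Y^{(k)}=u\,n_{(k)}^\top$ have rank one and $$\bigl\|\widehat X^{(k)}-Y^{(k)}\bigr\|_F\longrightarrow 0\quad\text{in probability as }k\to\infty .$$ (2) (Arbitrary $\tilde A$.) Let $\tilde A=PJP^{-1}$ be any complex Jordan decomposition of $\tilde A$, and let $P_{(1)}\in\mathbb{C}^{n\times d_{(1)}}$ be the submatrix of those columns of $P$ (generalized eigenvectors) that belong to eigenvalues of maximal modulus. Then there are matrices $V^{(k)}\in\mathbb{C}^{d_{(1)}\times d}$, $k\ge 0$, which are measurable functions of $X^{(0)}$, such that all the matrices $P_{(1)}V^{(k)}$ are real and $$\bigl\|\widehat X^{(k)}-P_{(1)}V^{(k)}\bigr\|_F\longrightarrow 0\quad\text{in probability as }k\to\infty .$$ -/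

import Mathlib

open MeasureTheory ProbabilityTheory Filter

-- Matrix norms below are Frobenius norms.
attribute [local instance] Matrix.frobeniusNormedAddCommGroup

noncomputable section

/-- Matrices carry the product (Borel) sigma-algebra of `ℝ^{n × d}` or `ℂ^{n × d}`. -/
instance matrixMeasurableSpace {ι κ R : Type*} [MeasurableSpace R] :
    MeasurableSpace (Matrix ι κ R) :=
  MeasurableSpace.pi

/-- The node representations `X^(k)` with `X^(0) = Z` and `X^(k) = A X^(k-1) W^(k)` for `k ≥ 1`
(the value `W 0` is never used). -/
def nodeRep {n d : ℕ} (A : Matrix (Fin n) (Fin n) ℝ) (W : ℕ → Matrix (Fin d) (Fin d) ℝ)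
    (Z : Matrix (Fin n) (Fin d) ℝ) : ℕ → Matrix (Fin n) (Fin d) ℝ
  | 0 => Z
  | k + 1 => A * nodeRep A W Z k * W (k + 1)

/-- The normalized matrix `M / ‖M‖_F`, with the convention that the zero matrix is normalized
to itself. -/
def normalizeF {n d : ℕ} (M : Matrix (Fin n) (Fin d) ℝ) : Matrix (Fin n) (Fin d) ℝ :=
  ‖M‖⁻¹ • M

/-- The uniform distribution on the box `[-m, m]^{n × d}`: Lebesgue measure on `ℝ^{n × d}`
conditioned on the box. -/
def uniformBox (n d : ℕ) (m : ℝ) : Measure (Matrix (Fin n) (Fin d) ℝ) :=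
  Measure.map (Matrix.of : (Fin n → Fin d → ℝ) → Matrix (Fin n) (Fin d) ℝ)
    (ProbabilityTheory.cond volume {f : Fin n → Fin d → ℝ | ∀ i j, f i j ∈ Set.Icc (-m) m})

/-- The real matrix `A`, seen as a complex matrix. -/
def toComplex {n d : ℕ} (A : Matrix (Fin n) (Fin d) ℝ) : Matrix (Fin n) (Fin d) ℂ :=
  A.map Complex.ofReal

/-- `lam` is the unique eigenvalue of maximal modulus: if the complex eigenvalues of `A`, listed
with algebraic multiplicity, are `lam = λ₁, λ₂, …, λₙ`, then `|λ₁| > |λᵢ|` for all `i > 1`. -/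
def IsDominantEigenvalue {n : ℕ} (A : Matrix (Fin n) (Fin n) ℝ) (lam : ℂ) : Prop :=
  ∃ s : Multiset ℂ, (toComplex A).charpoly.roots = lam ::ₘ s ∧ ∀ μ ∈ s, ‖μ‖ < ‖lam‖

/-- `u` is a real eigenvector of `A` for the eigenvalue `lam`. -/
def IsRealEigenvector {n : ℕ} (A : Matrix (Fin n) (Fin n) ℝ) (lam : ℂ) (u : Fin n → ℝ) : Prop :=
  u ≠ 0 ∧ (toComplex A).mulVec (fun i => (u i : ℂ)) = lam • (fun i => (u i : ℂ))

/-- The random sequence `X` exhibits rank collapse in probability under `μ`, and it is witnessed by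
the rank-one matrices `Y`. -/
def RankCollapseInProbability {n d : ℕ} (μ : Measure (Matrix (Fin n) (Fin d) ℝ))
    (X Y : ℕ → Matrix (Fin n) (Fin d) ℝ → Matrix (Fin n) (Fin d) ℝ) : Prop :=
  (∀ k Z, (Y k Z).rank = 1) ∧
    TendstoInMeasure μ (fun k Z => ‖normalizeF (X k Z) - Y k Z‖) atTop (fun _ => (0 : ℝ))

/-- `J` is a block diagonal matrix of Jordan blocks: it is upper bidiagonal, and each
superdiagonal entry is either `0` (between two blocks) or `1` (inside a block, where the
diagonal is constant). -/
structure IsJordanMatrix {n : ℕ} (J : Matrix (Fin n) (Fin n) ℂ) : Prop where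
  eq_zero : ∀ i j : Fin n, j ≠ i → (j : ℕ) ≠ (i : ℕ) + 1 → J i j = 0
  superdiag : ∀ i j : Fin n, (j : ℕ) = (i : ℕ) + 1 → J i j = 0 ∨ (J i j = 1 ∧ J i i = J j j)

/-- `A = P J P⁻¹` is a (complex) Jordan decomposition of the real matrix `A`. -/
structure IsJordanDecomposition {n : ℕ} (A : Matrix (Fin n) (Fin n) ℝ)
    (P J : Matrix (Fin n) (Fin n) ℂ) : Prop where
  jordan : IsJordanMatrix J
  isUnit : IsUnit P
  eq : toComplex A = P * J * P⁻¹

/-- The indices of the diagonal entries of `J` that have maximal modulus. -/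
abbrev DominantIndex {n : ℕ} (J : Matrix (Fin n) (Fin n) ℂ) : Type :=
  {i : Fin n // ∀ j : Fin n, ‖J j j‖ ≤ ‖J i i‖}

/-- The submatrix `P₍₁₎` of those columns of `P` (generalized eigenvectors) that belong to the
eigenvalues of maximal modulus. -/
def dominantColumns {n : ℕ} (P J : Matrix (Fin n) (Fin n) ℂ) :
    Matrix (Fin n) (DominantIndex J) ℂ :=
  P.submatrix id Subtype.val

end

/-! The recursion gives `X^(k) = A^k Z B` with `B = W^(1) ⋯ W^(k)`. Let `Q` be the spectral
projection of `A` onto the generalized eigenspaces of maximal modulus. It commutes with `A`, so the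
part of `X^(k)` outside the range of `Q` is `A^k (1 - Q) Z B`, of norm at most `‖A^k (1 - Q)‖ ‖Z‖
‖B‖`, where `‖Z‖` is bounded on the box.

The total norm is controlled from below by a small ball estimate
(`exists_uniformBox_norm_mul_mul_le`): outside an event of probability `ε`, `‖A^k Z B‖ > δ ‖A^k‖
‖B‖`, with `δ` independent of `k` and of the matrices. In the quotient `‖B‖` cancels, so the weights
play no role, and the error is at most a constant times `‖A^k (1 - Q)‖ / ‖A^k‖`.

This ratio tends to zero by a spectral gap: for some `r` below the maximal modulus, `A^k (1 - Q) =
o(r^k)`, while the inverse of `A^k` on the range of `Q` is `o(r^(-k))` or, for a simple eigenvalue,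
exactly `lam^(-k)`. `IsDominatedSplitting` records this. For a Jordan form, `Q = P D P⁻¹` with `D`
the coordinate projection onto the dominant indices; for a simple dominant eigenvalue, `Q = u wᵀ`
with `w` a left eigenvector. -/

open scoped Topology

/-! ### Growth of powers and a small ball estimate -/

/-- If the spectrum of `a` lies in the open disc of radius `r`, then `a ^ k = o(r ^ k)`. -/
theorem tendsto_norm_pow_div_pow_of_spectrum_lt {R : Type*} [NormedRing R] [NormedAlgebra ℂ R]
    [CompleteSpace R] (a : R) {r : ℝ} (hr : 0 < r) (h : ∀ z ∈ spectrum ℂ a, ‖z‖ < r) :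
    Tendsto (fun k : ℕ => ‖a ^ k‖ / r ^ k) atTop (𝓝 0) := by
  cases subsingleton_or_nontrivial R with
  | inl hs =>
    have h0 : ∀ k : ℕ, ‖a ^ k‖ / r ^ k = 0 := fun k => by
      rw [Subsingleton.elim (a ^ k) 0, norm_zero, zero_div]
    simp [h0]
  | inr hn =>
    lift r to NNReal using hr.le
    have hlt : spectralRadius ℂ a < r :=
      spectrum.spectralRadius_lt_of_forall_lt a (fun z hz => by exact_mod_cast h z hz)
    obtain ⟨q, h1, h2⟩ := ENNReal.lt_iff_exists_nnreal_btwn.mp hlt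
    have hqr : (q : ℝ) < r := by exact_mod_cast h2
    -- Gelfand's formula: eventually `‖a ^ k‖ ≤ q ^ k`, with `q < r`.
    have hev := (spectrum.pow_nnnorm_pow_one_div_tendsto_nhds_spectralRadius a).eventually_lt_const h1
    refine squeeze_zero' (Eventually.of_forall fun k => by positivity) ?_
      (tendsto_pow_atTop_nhds_zero_of_lt_one (r := (q : ℝ) / r) (by positivity)
        ((div_lt_one hr).mpr hqr))
    filter_upwards [hev, eventually_gt_atTop 0] with k hk hk0
    rw [div_pow]
    gcongr
    have hk0' : (0 : ℝ) < k := by exact_mod_cast hk0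
    have h3 : (‖a ^ k‖₊ : ENNReal) ≤ (q : ENNReal) ^ k := by
      have := ENNReal.rpow_le_rpow hk.le hk0'.le
      rwa [← ENNReal.rpow_mul, one_div, inv_mul_cancel₀ hk0'.ne', ENNReal.rpow_one,
        ENNReal.rpow_natCast] at this
    exact_mod_cast h3

/-- Uniform small ball estimate on bounded sets: a linear map that is not small on the unit ball
takes small values only on a set of small measure. -/
theorem exists_measure_norm_map_le {E F : Type*} [NormedAddCommGroup E] [NormedSpace ℝ E]
    [FiniteDimensional ℝ E] [MeasurableSpace E] [BorelSpace E] (μ : Measure E)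
    [μ.IsAddHaarMeasure] [NormedAddCommGroup F] [NormedSpace ℝ F] (R : ℝ) {c : ℝ} (hc : 0 < c)
    {ε : ENNReal} (hε : ε ≠ 0) :
    ∃ δ : ℝ, 0 < δ ∧ ∀ (L : E →ₗ[ℝ] F) (e : E) (s : ℝ), 0 < s → ‖e‖ ≤ 1 → c * s ≤ ‖L e‖ →
      μ {x | ‖x‖ ≤ R ∧ ‖L x‖ ≤ δ * s} ≤ ε := by
  have hB : μ (Metric.closedBall 0 (R + 1)) ≠ ⊤ := measure_closedBall_lt_top.ne
  obtain ⟨N, hN⟩ := ENNReal.exists_nat_mul_gt hε hB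
  have hN0 : N ≠ 0 := by rintro rfl; simp at hN
  have hNpos : (0 : ℝ) < N := by exact_mod_cast Nat.pos_of_ne_zero hN0
  -- On `S` the values of `L` differ by at most `2δs = (2/3) cs/N`, while a shift by `e/N` moves
  -- them by at least `cs/N`. Hence `N` shifts of `S` are disjoint; they fit in a ball of measure
  -- below `Nε`.
  refine ⟨c / (3 * N), by positivity, fun L e s hs he hLe => ?_⟩
  set S := {x : E | ‖x‖ ≤ R ∧ ‖L x‖ ≤ c / (3 * N) * s} with hS
  have hLc : Continuous L := L.continuous_of_finiteDimensional
  have hSm : MeasurableSet S :=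
    ((isClosed_le continuous_norm continuous_const).inter
      (isClosed_le hLc.norm continuous_const)).measurableSet
  let v : ℕ → E := fun i => ((i : ℝ) / N) • e
  let T : ℕ → Set E := fun i => (fun x => x + -v i) ⁻¹' S
  have hTm : ∀ i, MeasurableSet (T i) := fun i => (measurable_add_const _) hSm
  have hdisj : ((Finset.range N : Finset ℕ) : Set ℕ).PairwiseDisjoint T := by
    intro i _ j _ hij
    refine Set.disjoint_left.mpr fun x hxi hxj => ?_
    have h1 : ‖L (v i - v j)‖ ≤ 2 * (c / (3 * N) * s) := by
      have h : L (v i - v j) = L (x + -v j) - L (x + -v i) := by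
        rw [← map_sub]; congr 1; abel
      rw [h]
      linarith [norm_sub_le (L (x + -v j)) (L (x + -v i)), hxi.2, hxj.2]
    have h2 : c * s / N ≤ ‖L (v i - v j)‖ := by
      have h : v i - v j = (((i : ℝ) - j) / N) • e := by
        simp only [v, ← sub_smul, sub_div]
      have hone : (1 : ℝ) ≤ |(i : ℝ) - j| := by
        have : (1 : ℤ) ≤ |(i : ℤ) - j| := Int.one_le_abs (sub_ne_zero.mpr (by exact_mod_cast hij))
        exact_mod_cast this
      rw [h, map_smul, norm_smul, Real.norm_eq_abs, abs_div, abs_of_pos hNpos, div_mul_eq_mul_div]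
      exact div_le_div_of_nonneg_right
        (hLe.trans (le_mul_of_one_le_left (norm_nonneg _) hone)) hNpos.le
    have h3 : 2 * (c / (3 * N) * s) = 2 / 3 * (c * s / N) := by field_simp
    have h4 : 0 < c * s / N := by positivity
    linarith
  have hsub : (⋃ i ∈ Finset.range N, T i) ⊆ Metric.closedBall 0 (R + 1) := by
    intro x hx
    simp only [Set.mem_iUnion, Finset.mem_range] at hx
    obtain ⟨i, hi, hx⟩ := hx
    have hvi : ‖v i‖ ≤ 1 := by
      have hi' : (i : ℝ) / N ≤ 1 := (div_le_one hNpos).mpr (by exact_mod_cast hi.le)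
      simp only [v, norm_smul, Real.norm_eq_abs]
      rw [abs_of_nonneg (by positivity)]
      exact mul_le_one₀ hi' (norm_nonneg _) he
    rw [mem_closedBall_zero_iff]
    have : x = (x + -v i) + v i := by abel
    rw [this]
    linarith [norm_add_le (x + -v i) (v i), hx.1]
  have hsum : (N : ENNReal) * μ S ≤ N * ε := by
    calc (N : ENNReal) * μ S = ∑ i ∈ Finset.range N, μ (T i) := by
          simp only [T, measure_preimage_add_right]
          simp
      _ = μ (⋃ i ∈ Finset.range N, T i) := (measure_biUnion_finset hdisj fun i _ => hTm i).symm
      _ ≤ μ (Metric.closedBall 0 (R + 1)) := measure_mono hsub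
      _ ≤ N * ε := hN.le
  exact (ENNReal.mul_le_mul_iff_right (by exact_mod_cast hN0) (ENNReal.natCast_ne_top N)).mp hsum

/-! ### Frobenius norms and complexification -/

theorem Matrix.frobenius_norm_sq_eq_sum {ι κ R : Type*} [Fintype ι] [Fintype κ]
    [NormedAddCommGroup R] (M : Matrix ι κ R) : ‖M‖ ^ 2 = ∑ p : ι × κ, ‖M p.1 p.2‖ ^ 2 := by
  rw [Matrix.frobenius_norm_def, ← Real.sqrt_eq_rpow, Real.sq_sqrt (by positivity),
    Fintype.sum_prod_type]
  simp

theorem Matrix.norm_entry_le_frobenius_norm {ι κ R : Type*} [Fintype ι] [Fintype κ]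
    [NormedAddCommGroup R] (M : Matrix ι κ R) (i : ι) (j : κ) : ‖M i j‖ ≤ ‖M‖ := by
  refine le_of_sq_le_sq ?_ (norm_nonneg _)
  rw [Matrix.frobenius_norm_sq_eq_sum]
  exact Finset.single_le_sum (f := fun p : ι × κ => ‖M p.1 p.2‖ ^ 2)
    (fun p _ => by positivity) (Finset.mem_univ (i, j))

theorem Matrix.frobenius_norm_le_sum {ι κ R : Type*} [Fintype ι] [Fintype κ]
    [NormedAddCommGroup R] (M : Matrix ι κ R) : ‖M‖ ≤ ∑ p : ι × κ, ‖M p.1 p.2‖ := by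
  refine le_of_sq_le_sq ?_ (Finset.sum_nonneg fun _ _ => norm_nonneg _)
  rw [Matrix.frobenius_norm_sq_eq_sum]
  exact Finset.sum_sq_le_sq_sum_of_nonneg fun p _ => norm_nonneg _

theorem Matrix.frobenius_norm_mono {ι κ R S : Type*} [Fintype ι] [Fintype κ]
    [NormedAddCommGroup R] [NormedAddCommGroup S] (M : Matrix ι κ R) (N : Matrix ι κ S)
    (h : ∀ i j, ‖M i j‖ ≤ ‖N i j‖) : ‖M‖ ≤ ‖N‖ := by
  refine le_of_sq_le_sq ?_ (norm_nonneg _)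
  rw [Matrix.frobenius_norm_sq_eq_sum, Matrix.frobenius_norm_sq_eq_sum]
  exact Finset.sum_le_sum fun p _ => pow_le_pow_left₀ (norm_nonneg _) (h _ _) 2

theorem Matrix.exists_frobenius_norm_le_card_mul {ι κ R : Type*} [Fintype ι] [Fintype κ]
    [NormedAddCommGroup R] {M : Matrix ι κ R} (hM : M ≠ 0) :
    ∃ i j, ‖M‖ ≤ Fintype.card (ι × κ) * ‖M i j‖ := by
  obtain ⟨i₀, j₀, -⟩ : ∃ i j, M i j ≠ 0 := by
    by_contra! h
    exact hM (Matrix.ext h)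
  obtain ⟨p, -, hp⟩ := Finset.exists_max_image Finset.univ (fun p : ι × κ => ‖M p.1 p.2‖)
    ⟨(i₀, j₀), Finset.mem_univ _⟩
  refine ⟨p.1, p.2, (Matrix.frobenius_norm_le_sum M).trans ?_⟩
  rw [← nsmul_eq_mul, ← Finset.card_univ]
  exact Finset.sum_le_card_nsmul _ _ _ fun q hq => hp q hq

section toComplex

variable {n d e : ℕ}

theorem toComplex_mul (M : Matrix (Fin n) (Fin d) ℝ) (N : Matrix (Fin d) (Fin e) ℝ) :
    toComplex (M * N) = toComplex M * toComplex N :=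
  Matrix.map_mul (f := Complex.ofRealHom)

theorem toComplex_pow (A : Matrix (Fin n) (Fin n) ℝ) (k : ℕ) :
    toComplex (A ^ k) = toComplex A ^ k :=
  map_pow (Complex.ofRealHom.mapMatrix (m := Fin n)) A k

theorem norm_toComplex (M : Matrix (Fin n) (Fin d) ℝ) : ‖toComplex M‖ = ‖M‖ :=
  Matrix.frobenius_norm_map_eq M _ fun a => Complex.norm_real a

theorem toComplex_normalizeF (M : Matrix (Fin n) (Fin d) ℝ) :
    toComplex (normalizeF M) = ((‖M‖⁻¹ : ℝ) : ℂ) • toComplex M := by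
  ext i j
  simp [toComplex, normalizeF]

end toComplex

theorem nodeRep_eq {n d : ℕ} (A : Matrix (Fin n) (Fin n) ℝ) (W : ℕ → Matrix (Fin d) (Fin d) ℝ)
    (Z : Matrix (Fin n) (Fin d) ℝ) (k : ℕ) :
    nodeRep A W Z k = A ^ k * Z * ((List.range k).map (fun i => W (i + 1))).prod := by
  induction k with
  | zero => simp [nodeRep]
  | succ k ih =>
    rw [nodeRep, ih, List.range_succ, List.map_append, List.prod_append, pow_succ']
    simp [Matrix.mul_assoc]

/-- The linear map `Z ↦ A * Z * B` on the underlying functions of matrices. -/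
def mulMulLinearMap {n d : ℕ} (A : Matrix (Fin n) (Fin n) ℝ) (B : Matrix (Fin d) (Fin d) ℝ) :
    (Fin n → Fin d → ℝ) →ₗ[ℝ] Matrix (Fin n) (Fin d) ℝ where
  toFun f := A * Matrix.of f * B
  map_add' f g := by rw [← Matrix.of_add_of, Matrix.mul_add, Matrix.add_mul]
  map_smul' c f := by rw [← Matrix.smul_of, Matrix.mul_smul, Matrix.smul_mul]; rfl

/-- A matrix unit is a suitable witness: `A * E_ij * B` has the entry `A a i * B j b`, and the
indices can be chosen so that both factors are entries of largest modulus. The summands `+ 1` keep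
the constant positive even when `n` or `d` is zero. -/
theorem exists_norm_le_mul_norm_mulMulLinearMap {n d : ℕ} {A : Matrix (Fin n) (Fin n) ℝ}
    {B : Matrix (Fin d) (Fin d) ℝ} (hA : A ≠ 0) (hB : B ≠ 0) :
    ∃ e : Fin n → Fin d → ℝ, ‖e‖ ≤ 1 ∧
      ((((n * n : ℕ) : ℝ) + 1) * (((d * d : ℕ) : ℝ) + 1))⁻¹ * (‖A‖ * ‖B‖)
        ≤ ‖mulMulLinearMap A B e‖ := by
  obtain ⟨a, i, hi⟩ := Matrix.exists_frobenius_norm_le_card_mul hA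
  obtain ⟨j, b, hj⟩ := Matrix.exists_frobenius_norm_le_card_mul hB
  simp only [Fintype.card_prod, Fintype.card_fin] at hi hj
  refine ⟨fun x y => if x = i ∧ y = j then 1 else 0, ?_, ?_⟩
  · refine (pi_norm_le_iff_of_nonneg zero_le_one).mpr fun x =>
      (pi_norm_le_iff_of_nonneg zero_le_one).mpr fun y => ?_
    split_ifs <;> simp
  · have hent : mulMulLinearMap A B (fun x y => if x = i ∧ y = j then 1 else 0) a b
        = A a i * B j b := by
      simp [mulMulLinearMap, Matrix.mul_apply, Matrix.of_apply, ite_and]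
    have h1 := Matrix.norm_entry_le_frobenius_norm
      (mulMulLinearMap A B (fun x y => if x = i ∧ y = j then 1 else 0)) a b
    rw [hent, norm_mul] at h1
    refine le_trans ?_ h1
    rw [inv_mul_le_iff₀ (by positivity)]
    calc ‖A‖ * ‖B‖ ≤ (((n * n : ℕ) : ℝ) * ‖A a i‖) * (((d * d : ℕ) : ℝ) * ‖B j b‖) := by gcongr
      _ ≤ ((((n * n : ℕ) : ℝ) + 1) * ‖A a i‖) * ((((d * d : ℕ) : ℝ) + 1) * ‖B j b‖) := by
        gcongr <;> simp
      _ = _ := by ring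

/-! ### The uniform distribution on the box -/

section uniformBox

variable {n d : ℕ} {m : ℝ}

theorem uniformBox_apply (n d : ℕ) (m : ℝ) (S : Set (Matrix (Fin n) (Fin d) ℝ)) :
    uniformBox n d m S
      = ProbabilityTheory.cond volume {f : Fin n → Fin d → ℝ | ∀ i j, f i j ∈ Set.Icc (-m) m}
          {f | Matrix.of f ∈ S} :=
  MeasurableEquiv.map_apply (β := Matrix (Fin n) (Fin d) ℝ)
    { toEquiv := (Matrix.of : (Fin n → Fin d → ℝ) ≃ Matrix (Fin n) (Fin d) ℝ)
      measurable_toFun := measurable_id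
      measurable_invFun := measurable_id } S

theorem setOf_forall_mem_Icc_eq_closedBall (hm : 0 < m) :
    {f : Fin n → Fin d → ℝ | ∀ i j, f i j ∈ Set.Icc (-m) m} = Metric.closedBall 0 m := by
  ext f
  simp [pi_norm_le_iff_of_nonneg hm.le, abs_le]

theorem uniformBox_apply_eq (hm : 0 < m) (S : Set (Matrix (Fin n) (Fin d) ℝ)) :
    uniformBox n d m S = (volume (Metric.closedBall (0 : Fin n → Fin d → ℝ) m))⁻¹ *
      volume {f : Fin n → Fin d → ℝ | ‖f‖ ≤ m ∧ Matrix.of f ∈ S} := by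
  rw [uniformBox_apply, setOf_forall_mem_Icc_eq_closedBall hm,
    ProbabilityTheory.cond_apply measurableSet_closedBall]
  congr 2
  ext f
  simp

theorem ae_uniformBox_norm_le (hm : 0 < m) :
    ∀ᵐ Z ∂(uniformBox n d m), ‖Z‖ ≤ (n * d : ℕ) * m := by
  rw [ae_iff, uniformBox_apply_eq hm]
  convert! mul_zero _
  convert! measure_empty (μ := (volume : Measure (Fin n → Fin d → ℝ)))
  refine Set.eq_empty_of_forall_notMem fun f hf => hf.2 ?_
  refine (Matrix.frobenius_norm_le_sum _).trans ?_
  have := Finset.sum_le_card_nsmul Finset.univ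
    (fun p : Fin n × Fin d => ‖(Matrix.of f : Matrix (Fin n) (Fin d) ℝ) p.1 p.2‖) m
    (fun p _ => (norm_le_pi_norm (f p.1) p.2).trans ((norm_le_pi_norm f p.1).trans hf.1))
  simpa using this

theorem exists_uniformBox_norm_mul_mul_le (n d : ℕ) (hm : 0 < m) {ε : ENNReal} (hε : ε ≠ 0) :
    ∃ δ : ℝ, 0 < δ ∧ ∀ (A : Matrix (Fin n) (Fin n) ℝ) (B : Matrix (Fin d) (Fin d) ℝ),
      A ≠ 0 → B ≠ 0 → uniformBox n d m {Z | ‖A * Z * B‖ ≤ δ * (‖A‖ * ‖B‖)} ≤ ε := by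
  let _ : NormedSpace ℝ (Matrix (Fin n) (Fin d) ℝ) := Matrix.frobeniusNormedSpace
  have hV0 : volume (Metric.closedBall (0 : Fin n → Fin d → ℝ) m) ≠ 0 :=
    (Metric.measure_closedBall_pos volume 0 hm).ne'
  have hVt : volume (Metric.closedBall (0 : Fin n → Fin d → ℝ) m) ≠ ⊤ :=
    measure_closedBall_lt_top.ne
  obtain ⟨δ, hδ, h⟩ := exists_measure_norm_map_le (F := Matrix (Fin n) (Fin d) ℝ)
    (volume : Measure (Fin n → Fin d → ℝ)) m
    (c := ((((n * n : ℕ) : ℝ) + 1) * (((d * d : ℕ) : ℝ) + 1))⁻¹) (by positivity)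
    -- The tolerance is scaled by the volume of the box, which the normalization divides out again.
    (mul_ne_zero hV0 hε)
  refine ⟨δ, hδ, fun A B hA hB => ?_⟩
  obtain ⟨e, he, hLe⟩ := exists_norm_le_mul_norm_mulMulLinearMap hA hB
  have := h (mulMulLinearMap A B) e (‖A‖ * ‖B‖)
    (mul_pos (norm_pos_iff.mpr hA) (norm_pos_iff.mpr hB)) he hLe
  rw [uniformBox_apply_eq hm]
  calc _ ≤ _ := mul_le_mul_right this _
    _ = ε := by rw [← mul_assoc, ENNReal.inv_mul_cancel hV0 hVt, one_mul]

/-- The zero set lies in the small ball event for every `ε`. -/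
theorem ae_uniformBox_nodeRep_ne_zero (hm : 0 < m) (A : Matrix (Fin n) (Fin n) ℝ)
    (W : ℕ → Matrix (Fin d) (Fin d) ℝ) (k : ℕ) (hA : A ^ k ≠ 0)
    (hB : ((List.range k).map (fun i => W (i + 1))).prod ≠ 0) :
    ∀ᵐ Z ∂(uniformBox n d m), nodeRep A W Z k ≠ 0 := by
  rw [ae_iff]
  refine le_antisymm (ENNReal.le_of_forall_pos_le_add fun ε hε _ => ?_) zero_le
  obtain ⟨δ, hδ, h⟩ := exists_uniformBox_norm_mul_mul_le n d hm
    (ENNReal.coe_ne_zero.mpr hε.ne')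
  rw [zero_add]
  refine (measure_mono fun Z hZ => ?_).trans (h _ _ hA hB)
  simp only [ne_eq, not_not, Set.mem_ofPred_eq, nodeRep_eq] at hZ ⊢
  rw [hZ, norm_zero]
  positivity

end uniformBox

/-! ### From a spectral ratio to convergence in probability -/

theorem norm_toComplex_normalizeF_sub_mul_le {n d : ℕ} {A : Matrix (Fin n) (Fin n) ℝ}
    {Q : Matrix (Fin n) (Fin n) ℂ} (hQ : Commute Q (toComplex A))
    (W : ℕ → Matrix (Fin d) (Fin d) ℝ) (Z : Matrix (Fin n) (Fin d) ℝ) (k : ℕ) :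
    ‖toComplex (normalizeF (nodeRep A W Z k)) - Q * toComplex (normalizeF (nodeRep A W Z k))‖
      ≤ ‖nodeRep A W Z k‖⁻¹ * (‖toComplex A ^ k * (1 - Q)‖ * ‖Z‖ *
        ‖((List.range k).map (fun i => W (i + 1))).prod‖) := by
  set B := ((List.range k).map (fun i => W (i + 1))).prod
  have hk : Q * toComplex A ^ k = toComplex A ^ k * Q := (hQ.pow_right k).eq
  have h : toComplex (normalizeF (nodeRep A W Z k))
      - Q * toComplex (normalizeF (nodeRep A W Z k))
      = ((‖nodeRep A W Z k‖⁻¹ : ℝ) : ℂ) •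
        (toComplex A ^ k * (1 - Q) * toComplex Z * toComplex B) := by
    rw [toComplex_normalizeF, Matrix.mul_smul, ← smul_sub, nodeRep_eq, toComplex_mul,
      toComplex_mul, toComplex_pow, Matrix.mul_sub, ← hk]
    simp only [Matrix.sub_mul, Matrix.mul_one, Matrix.mul_assoc, B]
  rw [h, @norm_smul _ _ _ _ _ Matrix.frobeniusNormSMulClass, Complex.norm_real, norm_inv,
    norm_norm, ← norm_toComplex Z, ← norm_toComplex B]
  gcongr
  exact (Matrix.frobenius_norm_mul _ _).trans
    (mul_le_mul_of_nonneg_right (Matrix.frobenius_norm_mul _ _) (norm_nonneg _))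

/-- If `Q` commutes with `A` and `A ^ k * (1 - Q)` is negligible against `A ^ k`, then the
normalized node representations approach their images under `Q` in probability. -/
theorem tendstoInMeasure_normalizeF_sub_mul {n d : ℕ} {m : ℝ} (hm : 0 < m)
    {A : Matrix (Fin n) (Fin n) ℝ} {Q : Matrix (Fin n) (Fin n) ℂ}
    (hQ : Commute Q (toComplex A)) (W : ℕ → Matrix (Fin d) (Fin d) ℝ)
    (h : Tendsto (fun k => ‖toComplex A ^ k * (1 - Q)‖ / ‖A ^ k‖) atTop (𝓝 0)) :
    TendstoInMeasure (uniformBox n d m)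
      (fun k Z => ‖toComplex (normalizeF (nodeRep A W Z k))
        - Q * toComplex (normalizeF (nodeRep A W Z k))‖) atTop (fun _ => (0 : ℝ)) := by
  rw [tendstoInMeasure_iff_norm]
  intro ε hε
  rw [ENNReal.tendsto_nhds_zero]
  intro η hη
  obtain ⟨δ, hδ, hball⟩ := exists_uniformBox_norm_mul_mul_le n d hm hη.ne'
  have hlim := h.const_mul (((n * d : ℕ) : ℝ) * m / δ)
  rw [mul_zero] at hlim
  filter_upwards [hlim.eventually_lt_const hε] with k hk
  set B := ((List.range k).map (fun i => W (i + 1))).prod with hB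
  simp only [sub_zero, norm_norm]
  -- In the degenerate case `X^(k) = 0` everywhere, and the convention `0⁻¹ = 0` makes the error
  -- vanish.
  by_cases h0 : A ^ k = 0 ∨ B = 0
  · have hX : ∀ Z, nodeRep A W Z k = 0 := fun Z => by
      rw [nodeRep_eq, ← hB]
      rcases h0 with h0 | h0 <;> simp [h0]
    have : {Z : Matrix (Fin n) (Fin d) ℝ | ε ≤ ‖toComplex (normalizeF (nodeRep A W Z k))
        - Q * toComplex (normalizeF (nodeRep A W Z k))‖} = ∅ := by
      refine Set.eq_empty_of_forall_notMem fun Z hZ => ?_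
      have := norm_toComplex_normalizeF_sub_mul_le hQ W Z k
      rw [hX, norm_zero, inv_zero, zero_mul, ← hX Z] at this
      exact absurd (le_trans hZ this) (not_le.mpr hε)
    rw [this, measure_empty]
    exact zero_le
  · push Not at h0
    refine (measure_mono_ae ?_).trans (hball (A ^ k) B h0.1 h0.2)
    filter_upwards [ae_uniformBox_norm_le hm] with Z hZ hmem
    by_contra hlt
    have hlt' : δ * (‖A ^ k‖ * ‖B‖) < ‖nodeRep A W Z k‖ := by
      rw [nodeRep_eq]
      exact not_le.mp hlt
    have hA : 0 < ‖A ^ k‖ := norm_pos_iff.mpr h0.1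
    have hBp : 0 < ‖B‖ := norm_pos_iff.mpr h0.2
    have : ε < ε := calc
      ε ≤ _ := hmem
      _ ≤ _ := norm_toComplex_normalizeF_sub_mul_le hQ W Z k
      _ ≤ (δ * (‖A ^ k‖ * ‖B‖))⁻¹ *
          (‖toComplex A ^ k * (1 - Q)‖ * (((n * d : ℕ) : ℝ) * m) * ‖B‖) := by
        gcongr
      -- The weights disappear here: `‖B‖` cancels.
      _ = ((n * d : ℕ) : ℝ) * m / δ * (‖toComplex A ^ k * (1 - Q)‖ / ‖A ^ k‖) := by
        field_simp
      _ < ε := hk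
    exact lt_irrefl _ this

/-! ### Dominated splittings -/

theorem Matrix.tendsto_frobenius_norm_pow_div_pow {n : ℕ} (M : Matrix (Fin n) (Fin n) ℂ) {r : ℝ}
    (hr : 0 < r) (h : ∀ z ∈ spectrum ℂ M, ‖z‖ < r) :
    Tendsto (fun k : ℕ => ‖M ^ k‖ / r ^ k) atTop (𝓝 0) :=
  let _ : NormedRing (Matrix (Fin n) (Fin n) ℂ) := Matrix.frobeniusNormedRing
  let _ : NormedAlgebra ℂ (Matrix (Fin n) (Fin n) ℂ) := Matrix.frobeniusNormedAlgebra
  have : CompleteSpace (Matrix (Fin n) (Fin n) ℂ) := FiniteDimensional.complete ℂ _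
  tendsto_norm_pow_div_pow_of_spectrum_lt M hr h

/-- `Q` is a spectral projection of `A` such that the powers of `A` on the kernel of `Q` are
negligible against the powers of `A` on the range of `Q`, where `A` is invertible. -/
def IsDominatedSplitting {n : ℕ} (A Q : Matrix (Fin n) (Fin n) ℂ) : Prop :=
  ∃ G : ℕ → Matrix (Fin n) (Fin n) ℂ,
    (∀ᶠ k in atTop, A ^ k * G k = Q ∧ G k * A ^ k = Q) ∧
    Tendsto (fun k => ‖A ^ k * (1 - Q)‖ * ‖G k‖) atTop (𝓝 0)

namespace IsDominatedSplitting

variable {n : ℕ}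

/-- From `Q = A ^ k * G k` follows `‖Q‖ ≤ ‖A ^ k‖ * ‖G k‖`, so `1 / ‖A ^ k‖` is at most `‖G k‖ /
‖Q‖`. -/
theorem tendsto_div {A Q : Matrix (Fin n) (Fin n) ℂ} (h : IsDominatedSplitting A Q) (hQ : Q ≠ 0) :
    Tendsto (fun k => ‖A ^ k * (1 - Q)‖ / ‖A ^ k‖) atTop (𝓝 0) := by
  obtain ⟨G, hG, hlim⟩ := h
  have hQ0 : 0 < ‖Q‖ := norm_pos_iff.mpr hQ
  have hlim' := hlim.div_const ‖Q‖
  rw [zero_div] at hlim'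
  refine squeeze_zero' (Eventually.of_forall fun k => by positivity) ?_ hlim'
  filter_upwards [hG] with k hk
  have h1 : ‖Q‖ ≤ ‖A ^ k‖ * ‖G k‖ := by
    rw [← hk.1]
    exact Matrix.frobenius_norm_mul _ _
  have hA : 0 < ‖A ^ k‖ := by
    by_contra hA
    have hA0 : ‖A ^ k‖ = 0 := le_antisymm (not_lt.mp hA) (norm_nonneg _)
    rw [hA0, zero_mul] at h1
    linarith
  rw [div_le_div_iff₀ hA hQ0]
  calc ‖A ^ k * (1 - Q)‖ * ‖Q‖ ≤ ‖A ^ k * (1 - Q)‖ * (‖A ^ k‖ * ‖G k‖) := by gcongr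
    _ = _ := by ring

theorem conj {J D P : Matrix (Fin n) (Fin n) ℂ} (h : IsDominatedSplitting J D) (hP : IsUnit P) :
    IsDominatedSplitting (P * J * P⁻¹) (P * D * P⁻¹) := by
  obtain ⟨G, hG, hlim⟩ := h
  have hdet : IsUnit P.det := (Matrix.isUnit_iff_isUnit_det P).mp hP
  have hmul : ∀ M N : Matrix (Fin n) (Fin n) ℂ,
      P * M * P⁻¹ * (P * N * P⁻¹) = P * (M * N) * P⁻¹ := fun M N => by
    simp only [Matrix.mul_assoc, Matrix.nonsing_inv_mul_cancel_left _ _ hdet]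
  have hpow : ∀ k : ℕ, (P * J * P⁻¹) ^ k = P * J ^ k * P⁻¹ := fun k => by
    induction k with
    | zero => simp [Matrix.mul_nonsing_inv _ hdet]
    | succ k ih => rw [pow_succ, ih, hmul, pow_succ]
  have hone : 1 - P * D * P⁻¹ = P * (1 - D) * P⁻¹ := by
    rw [Matrix.mul_sub, Matrix.sub_mul, Matrix.mul_one, Matrix.mul_nonsing_inv _ hdet]
  have hnorm : ∀ M : Matrix (Fin n) (Fin n) ℂ, ‖P * M * P⁻¹‖ ≤ ‖P‖ * ‖M‖ * ‖P⁻¹‖ := fun M =>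
    (Matrix.frobenius_norm_mul _ _).trans
      (mul_le_mul_of_nonneg_right (Matrix.frobenius_norm_mul _ _) (norm_nonneg _))
  refine ⟨fun k => P * G k * P⁻¹, ?_, ?_⟩
  · filter_upwards [hG] with k hk
    rw [hpow, hmul, hmul, hk.1, hk.2]
    exact ⟨rfl, rfl⟩
  · have hlim' := hlim.const_mul (‖P‖ * ‖P⁻¹‖ * (‖P‖ * ‖P⁻¹‖))
    rw [mul_zero] at hlim'
    refine squeeze_zero (fun k => by positivity) (fun k => ?_) hlim'
    rw [hpow, hone, hmul]
    calc _ ≤ (‖P‖ * ‖J ^ k * (1 - D)‖ * ‖P⁻¹‖) * (‖P‖ * ‖G k‖ * ‖P⁻¹‖) :=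
          mul_le_mul (hnorm _) (hnorm _) (norm_nonneg _) (by positivity)
      _ = _ := by ring

/-- The spectral projection of a dominated splitting of a real matrix is real. -/
theorem map_conj_eq {A : Matrix (Fin n) (Fin n) ℝ} {Q : Matrix (Fin n) (Fin n) ℂ}
    (h : IsDominatedSplitting (toComplex A) Q) (hQ : Commute Q (toComplex A)) :
    (starRingEnd ℂ).mapMatrix Q = Q := by
  obtain ⟨G, hG, hlim⟩ := h
  set φ : Matrix (Fin n) (Fin n) ℂ →+* Matrix (Fin n) (Fin n) ℂ := (starRingEnd ℂ).mapMatrix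
  have hφA : φ (toComplex A) = toComplex A := by
    ext i j
    simp [φ, toComplex]
  have hφφ : φ (φ Q) = Q := by
    ext i j
    simp [φ]
  have hφn : ∀ M, ‖φ M‖ = ‖M‖ := fun M =>
    Matrix.frobenius_norm_map_eq M _ fun a => by simp
  -- A fixed matrix bounded by a null sequence is zero. It is applied to `(1 - Q) * φ Q = A ^ k * (1
  -- - Q) * φ (G k)` and to its mirror image.
  have key : ∀ M : Matrix (Fin n) (Fin n) ℂ,
      (∀ᶠ k in atTop, ‖M‖ ≤ ‖toComplex A ^ k * (1 - Q)‖ * ‖G k‖) → M = 0 := fun M hM =>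
    norm_le_zero_iff.mp (ge_of_tendsto hlim hM)
  have h1 : (1 - Q) * φ Q = 0 := by
    refine key _ ?_
    filter_upwards [hG] with k hk
    have e : φ Q = toComplex A ^ k * φ (G k) := by rw [← hk.1, map_mul, map_pow, hφA]
    have hc : (1 - Q) * toComplex A ^ k = toComplex A ^ k * (1 - Q) :=
      (((Commute.one_left _).sub_left hQ).pow_right k).eq
    rw [e, ← Matrix.mul_assoc, hc, ← hφn (G k)]
    exact Matrix.frobenius_norm_mul _ _
  have h2 : φ Q * (1 - Q) = 0 := by
    refine key _ ?_
    filter_upwards [hG] with k hk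
    have e : φ Q = φ (G k) * toComplex A ^ k := by
      conv_lhs => rw [← hk.2, map_mul, map_pow, hφA]
    rw [e, Matrix.mul_assoc, ← hφn (G k), mul_comm ‖_ * _‖]
    exact Matrix.frobenius_norm_mul _ _
  rw [Matrix.sub_mul, Matrix.one_mul, sub_eq_zero] at h1
  rw [Matrix.mul_sub, Matrix.mul_one, sub_eq_zero] at h2
  -- Conjugating `φ Q = Q * φ Q` gives `Q = φ Q * Q`, and the right side is `φ Q` by `h2`.
  have h3 := congrArg φ h1
  rw [map_mul, hφφ] at h3
  exact h2.trans h3.symm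

end IsDominatedSplitting

/-! ### The spectral gap of a Jordan matrix -/

section Jordan

variable {n : ℕ} {J : Matrix (Fin n) (Fin n) ℂ}

theorem Matrix.exists_eq_diag_of_mem_spectrum {M : Matrix (Fin n) (Fin n) ℂ}
    (hM : ∀ i j, j < i → M i j = 0) {z : ℂ} (hz : z ∈ spectrum ℂ M) : ∃ i, z = M i i := by
  rw [Matrix.mem_spectrum_iff_isRoot_charpoly,
    Matrix.charpoly_of_isUpperTriangular M (fun i j hij => hM i j hij), Polynomial.isRoot_prod] at hz
  obtain ⟨i, -, hi⟩ := hz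
  refine ⟨i, ?_⟩
  simpa [sub_eq_zero] using hi

theorem IsJordanMatrix.diag_eq (hJ : IsJordanMatrix J) {i j : Fin n} (h : J i j ≠ 0) :
    J i i = J j j := by
  by_cases hij : j = i
  · rw [hij]
  · by_cases hs : (j : ℕ) = (i : ℕ) + 1
    · exact ((hJ.superdiag i j hs).resolve_left h).2
    · exact absurd (hJ.eq_zero i j hij hs) h

theorem IsJordanMatrix.eq_zero_of_lt (hJ : IsJordanMatrix J) {i j : Fin n} (h : j < i) :
    J i j = 0 :=
  hJ.eq_zero i j h.ne (by have : (j : ℕ) < i := h; omega)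

/-- The coordinate projection onto the dominant indices. -/
noncomputable def dominantDiagonal (J : Matrix (Fin n) (Fin n) ℂ) : Matrix (Fin n) (Fin n) ℂ :=
  open Classical in
  Matrix.diagonal fun i => if ∀ j : Fin n, ‖J j j‖ ≤ ‖J i i‖ then 1 else 0

theorem isIdempotentElem_dominantDiagonal : IsIdempotentElem (dominantDiagonal J) := by
  simp [IsIdempotentElem, dominantDiagonal, Matrix.diagonal_mul_diagonal]

theorem IsJordanMatrix.commute_dominantDiagonal (hJ : IsJordanMatrix J) :
    Commute (dominantDiagonal J) J := by
  ext i j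
  rw [dominantDiagonal, Matrix.diagonal_mul, Matrix.mul_diagonal]
  by_cases h : J i j = 0
  · simp [h]
  · rw [hJ.diag_eq h, mul_comm]

theorem Commute.mul_pow_of_isIdempotentElem {R : Type*} [Monoid R] {a p : R} (h : Commute a p)
    (hp : IsIdempotentElem p) {k : ℕ} (hk : k ≠ 0) : (a * p) ^ k = a ^ k * p := by
  rw [h.mul_pow, hp.pow_eq hk]

/-- If not all indices are dominant, the maximal modulus `ρ` exceeds some other modulus and is
therefore positive. So `J` is invertible on the dominant block, and a rate `r` fits strictly between
the two groups of moduli. -/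
theorem IsJordanMatrix.isDominatedSplitting (hJ : IsJordanMatrix J)
    (hne : dominantDiagonal J ≠ 1) :
    IsDominatedSplitting J (dominantDiagonal J) ∧ dominantDiagonal J ≠ 0 := by
  classical
  set D := dominantDiagonal J with hD
  have hDi : IsIdempotentElem D := isIdempotentElem_dominantDiagonal
  have hDJ : Commute D J := hJ.commute_dominantDiagonal
  obtain ⟨i₀, hi₀⟩ : ∃ i, ¬ ∀ j, ‖J j j‖ ≤ ‖J i i‖ := by
    by_contra! h
    refine hne ?_
    rw [hD, dominantDiagonal, ← Matrix.diagonal_one]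
    congr 1
    funext i
    exact if_pos (h i)
  obtain ⟨i₁, -, hi₁⟩ := Finset.exists_max_image Finset.univ (fun i => ‖J i i‖)
    ⟨i₀, Finset.mem_univ _⟩
  replace hi₁ : ∀ j, ‖J j j‖ ≤ ‖J i₁ i₁‖ := fun j => hi₁ j (Finset.mem_univ j)
  set ρ := ‖J i₁ i₁‖ with hρ
  have hDone : ∀ i, (∀ j, ‖J j j‖ ≤ ‖J i i‖) → D i i = 1 := fun i hi => by
    rw [hD, dominantDiagonal, Matrix.diagonal_apply_eq, if_pos hi]
  have hDzero : ∀ i, (¬ ∀ j, ‖J j j‖ ≤ ‖J i i‖) → D i i = 0 := fun i hi => by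
    rw [hD, dominantDiagonal, Matrix.diagonal_apply_eq, if_neg hi]
  have hDoff : ∀ i j, i ≠ j → D i j = 0 := fun i j hij => by
    rw [hD, dominantDiagonal, Matrix.diagonal_apply_ne _ hij]
  have hρ0 : 0 < ρ := by
    push Not at hi₀
    obtain ⟨j, hj⟩ := hi₀
    exact (norm_nonneg _).trans_lt (hj.trans_le (hi₁ j))
  have hJD : ∀ i j, (J * D) i j = J i j * D j j := fun i j => by
    rw [hD, dominantDiagonal, Matrix.mul_diagonal, Matrix.diagonal_apply_eq]
  refine ⟨?_, fun h0 => ?_⟩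
  swap
  · have := hDone i₁ hi₁
    rw [h0] at this
    simp at this
  have hM1 : ∀ i j, (J * (1 - D)) i j = J i j * (1 - D j j) := fun i j => by
    rw [Matrix.mul_sub, Matrix.mul_one, Matrix.sub_apply, hJD]
    ring
  have hdiag1 : ∀ i, ‖(J * (1 - D)) i i‖ < ρ := fun i => by
    rw [hM1]
    by_cases hi : ∀ j, ‖J j j‖ ≤ ‖J i i‖
    · simpa [hDone i hi] using hρ0
    · rw [hDzero i hi, sub_zero, mul_one]
      push Not at hi
      obtain ⟨j, hj⟩ := hi
      exact hj.trans_le (hi₁ j)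
  obtain ⟨r, hr1, hr0, hrρ⟩ : ∃ r, (∀ i, ‖(J * (1 - D)) i i‖ < r) ∧ 0 < r ∧ r < ρ :=
    ((eventually_all.mpr fun i => mem_of_superset (Ioo_mem_nhdsLT (hdiag1 i)) fun _ h => h.1).and
      (Ioo_mem_nhdsLT hρ0)).exists
  have hlim1 : Tendsto (fun k : ℕ => ‖(J * (1 - D)) ^ k‖ / r ^ k) atTop (𝓝 0) := by
    refine Matrix.tendsto_frobenius_norm_pow_div_pow _ hr0 fun z hz => ?_
    obtain ⟨i, rfl⟩ := Matrix.exists_eq_diag_of_mem_spectrum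
      (fun i j hij => by rw [hM1, hJ.eq_zero_of_lt hij, zero_mul]) hz
    exact hr1 i
  -- Filling the complementary block with `ρ` makes the matrix invertible with spectrum on the
  -- circle of radius `ρ`, without changing it on the range of `D`.
  set M := J * D + (ρ : ℂ) • (1 - D) with hM
  have hMdiag : ∀ i, ‖M i i‖ = ρ := fun i => by
    have : M i i = J i i * D i i + ρ * (1 - D i i) := by
      rw [hM, Matrix.add_apply, hJD]
      simp
    rw [this]
    by_cases hi : ∀ j, ‖J j j‖ ≤ ‖J i i‖
    · rw [hDone i hi, sub_self, mul_zero, add_zero, mul_one]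
      exact le_antisymm (hi₁ i) (hi i₁)
    · rw [hDzero i hi]
      simp [hρ0.le]
  have hMspec : ∀ z ∈ spectrum ℂ M, ‖z‖ = ρ := fun z hz => by
    obtain ⟨i, rfl⟩ := Matrix.exists_eq_diag_of_mem_spectrum (fun i j hij => by
      rw [hM, Matrix.add_apply, hJD, hJ.eq_zero_of_lt hij, Matrix.smul_apply, Matrix.sub_apply,
        hDoff i j hij.ne', Matrix.one_apply_ne hij.ne']
      simp) hz
    exact hMdiag i
  have hMu : IsUnit M := by
    rw [← spectrum.zero_notMem_iff ℂ]
    intro h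
    have := hMspec 0 h
    rw [norm_zero] at this
    exact hρ0.ne this
  obtain ⟨u, hu⟩ := hMu
  have hDM : Commute D M :=
    (hDJ.mul_right (Commute.refl D)).add_right
      (((Commute.one_right D).sub_right (Commute.refl D)).smul_right _)
  have hlim2 : Tendsto (fun k : ℕ => ‖(↑u⁻¹ : Matrix (Fin n) (Fin n) ℂ) ^ k‖ / (r⁻¹) ^ k) atTop
      (𝓝 0) := by
    refine Matrix.tendsto_frobenius_norm_pow_div_pow _ (inv_pos.mpr hr0) fun z hz => ?_
    have hz' : z⁻¹ ∈ spectrum ℂ (u : Matrix (Fin n) (Fin n) ℂ) := spectrum.inv₀_mem_iff.mpr hz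
    rw [hu] at hz'
    have := hMspec _ hz'
    rw [norm_inv, inv_eq_iff_eq_inv] at this
    rw [this]
    exact inv_strictAnti₀ hr0 hrρ
  have hMD : M * D = J * D := by
    rw [hM, Matrix.add_mul, Matrix.mul_assoc, hDi.eq, Matrix.smul_mul, Matrix.sub_mul, hDi.eq,
      Matrix.one_mul, sub_self, smul_zero, add_zero]
  have hDu : Commute D (↑u⁻¹ : Matrix (Fin n) (Fin n) ℂ) :=
    Commute.units_inv_right (by rw [hu]; exact hDM)
  have hpowD : ∀ k : ℕ, k ≠ 0 → J ^ k * D = M ^ k * D := fun k hk => by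
    rw [← hDJ.symm.mul_pow_of_isIdempotentElem hDi hk,
      ← hDM.symm.mul_pow_of_isIdempotentElem hDi hk, hMD]
  have hinv : ∀ k : ℕ, (↑u⁻¹ : Matrix (Fin n) (Fin n) ℂ) ^ k * M ^ k = 1 := fun k => by
    rw [← hu, ← Units.val_pow_eq_pow_val, ← Units.val_pow_eq_pow_val, inv_pow, Units.inv_mul]
  have hinv' : ∀ k : ℕ, M ^ k * (↑u⁻¹ : Matrix (Fin n) (Fin n) ℂ) ^ k = 1 := fun k => by
    rw [← hu, ← Units.val_pow_eq_pow_val, ← Units.val_pow_eq_pow_val, inv_pow, Units.mul_inv]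
  -- The identities hold only for `k ≠ 0`: the zeroth power of `J * D` is `1`, not `D`.
  refine ⟨fun k => (↑u⁻¹ : Matrix (Fin n) (Fin n) ℂ) ^ k * D, ?_, ?_⟩
  · filter_upwards [eventually_ne_atTop 0] with k hk
    constructor
    · rw [← (hDu.pow_right k).eq, ← Matrix.mul_assoc, hpowD k hk, ← (hDM.pow_right k).eq,
        Matrix.mul_assoc, hinv', Matrix.mul_one]
    · rw [Matrix.mul_assoc, (hDJ.pow_right k).eq, hpowD k hk, ← Matrix.mul_assoc, hinv,
        Matrix.one_mul]
  -- The rates `r ^ k` and `r⁻¹ ^ k` cancel in the product.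
  · have hlim := (hlim1.mul hlim2).mul_const ‖D‖
    rw [zero_mul, zero_mul] at hlim
    refine squeeze_zero' (Eventually.of_forall fun k => by positivity) ?_ hlim
    filter_upwards [eventually_ne_atTop 0] with k hk
    have hc : Commute J (1 - D) := (Commute.one_right J).sub_right hDJ.symm
    rw [← hc.mul_pow_of_isIdempotentElem hDi.one_sub hk]
    calc _ ≤ ‖(J * (1 - D)) ^ k‖ * (‖(↑u⁻¹ : Matrix (Fin n) (Fin n) ℂ) ^ k‖ * ‖D‖) :=
          mul_le_mul_of_nonneg_left (Matrix.frobenius_norm_mul _ _) (norm_nonneg _)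
      _ = _ := by
        rw [inv_pow]
        field_simp

/-- The submatrix of the rows of `R` with dominant index. -/
def dominantRows (R J : Matrix (Fin n) (Fin n) ℂ) : Matrix (DominantIndex J) (Fin n) ℂ :=
  R.submatrix Subtype.val id

theorem dominantColumns_mul_dominantRows (P R J : Matrix (Fin n) (Fin n) ℂ) :
    dominantColumns P J * dominantRows R J = P * dominantDiagonal J * R := by
  classical
  ext a b
  rw [Matrix.mul_apply, Matrix.mul_apply]
  simp only [dominantColumns, dominantRows, dominantDiagonal, Matrix.mul_diagonal, Matrix.submatrix_apply, id,
    mul_ite, ite_mul, mul_one, mul_zero, zero_mul]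
  rw [← Finset.sum_filter]
  exact (Finset.sum_subtype (p := fun i => ∀ j : Fin n, ‖J j j‖ ≤ ‖J i i‖) _ (by simp)
    (fun i => P a i * R i b)).symm

end Jordan

/-! ### Measurability -/

section measurable

variable {n d : ℕ}

theorem measurable_matrix_entry {ι κ R : Type*} [MeasurableSpace R] (i : ι) (j : κ) :
    Measurable fun M : Matrix ι κ R => M i j :=
  (measurable_pi_apply j).comp (measurable_pi_apply i)

theorem measurable_matrix_iff {α ι κ R : Type*} [MeasurableSpace α] [MeasurableSpace R]
    {f : α → Matrix ι κ R} : Measurable f ↔ ∀ i j, Measurable fun a => f a i j :=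
  measurable_pi_iff.trans (forall_congr' fun _ => measurable_pi_iff)

theorem measurable_normalizeF_nodeRep_entry (A : Matrix (Fin n) (Fin n) ℝ)
    (W : ℕ → Matrix (Fin d) (Fin d) ℝ) (k : ℕ) (i : Fin n) (j : Fin d) :
    Measurable fun Z => normalizeF (nodeRep A W Z k) i j := by
  have hX : ∀ i j, Measurable fun Z : Matrix (Fin n) (Fin d) ℝ => nodeRep A W Z k i j := by
    intro i j
    simp only [nodeRep_eq, Matrix.mul_apply]
    exact Finset.measurable_sum _ fun x _ => (Finset.measurable_sum _ fun y _ =>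
      (measurable_matrix_entry y x).const_mul _).mul_const _
  have hn : Measurable fun Z : Matrix (Fin n) (Fin d) ℝ => ‖nodeRep A W Z k‖ := by
    simp only [Matrix.frobenius_norm_def]
    exact (Finset.measurable_sum _ fun x _ => Finset.measurable_sum _ fun y _ =>
      (hX x y).norm.pow_const _).pow_const _
  exact hn.inv.mul (hX i j)

theorem measurable_mul_toComplex_normalizeF_nodeRep {ι : Type*} (A : Matrix (Fin n) (Fin n) ℝ)
    (W : ℕ → Matrix (Fin d) (Fin d) ℝ) (k : ℕ) (R : Matrix ι (Fin n) ℂ) :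
    Measurable fun Z => R * toComplex (normalizeF (nodeRep A W Z k)) := by
  refine measurable_matrix_iff.mpr fun i j => ?_
  simp only [Matrix.mul_apply]
  exact Finset.measurable_sum _ fun x _ =>
    (Complex.measurable_ofReal.comp (measurable_normalizeF_nodeRep_entry A W k x j)).const_mul _

end measurable

/-! ### Arbitrary matrices -/

/-- `V k` consists of the dominant coordinates of the normalized matrix in the basis of columns of
`P`, so that `dominantColumns P J * V k` is its image under `Q`. -/
theorem exists_tendstoInMeasure_dominantColumns {n d : ℕ} {A : Matrix (Fin n) (Fin n) ℝ}
    (W : ℕ → Matrix (Fin d) (Fin d) ℝ) {m : ℝ} (hm : 0 < m) {P J : Matrix (Fin n) (Fin n) ℂ}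
    (h : IsJordanDecomposition A P J) :
    ∃ V : ℕ → Matrix (Fin n) (Fin d) ℝ → Matrix (DominantIndex J) (Fin d) ℂ,
      (∀ k, Measurable (V k)) ∧
      (∀ k Z i j, ((dominantColumns P J * V k Z) i j).im = 0) ∧
      TendstoInMeasure (uniformBox n d m)
        (fun k Z => ‖toComplex (normalizeF (nodeRep A W Z k)) - dominantColumns P J * V k Z‖)
        atTop (fun _ => (0 : ℝ)) := by
  set Q := P * dominantDiagonal J * P⁻¹ with hQdef
  have hdet : IsUnit P.det := (Matrix.isUnit_iff_isUnit_det P).mp h.isUnit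
  obtain ⟨hQA, hreal, hlim⟩ : Commute Q (toComplex A) ∧ (starRingEnd ℂ).mapMatrix Q = Q ∧
      Tendsto (fun k => ‖toComplex A ^ k * (1 - Q)‖ / ‖A ^ k‖) atTop (𝓝 0) := by
    -- When all moduli agree, `Q = 1` and there is no error. This case stands apart because `A` may
    -- be nilpotent, and then no dominated splitting with `Q = 1` need exist.
    by_cases h1 : dominantDiagonal J = 1
    · have hQ1 : Q = 1 := by rw [hQdef, h1, Matrix.mul_one, Matrix.mul_nonsing_inv _ hdet]
      rw [hQ1]
      refine ⟨Commute.one_left _, map_one _, ?_⟩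
      simp
    · obtain ⟨hs, hD0⟩ := h.jordan.isDominatedSplitting h1
      have hs' : IsDominatedSplitting (toComplex A) Q := h.eq ▸ hs.conj h.isUnit
      have hc : Commute Q (toComplex A) := by
        rw [h.eq, hQdef, commute_iff_eq]
        have := h.jordan.commute_dominantDiagonal.eq
        simp only [Matrix.mul_assoc, Matrix.nonsing_inv_mul_cancel_left _ _ hdet]
        rw [← Matrix.mul_assoc (dominantDiagonal J), this, Matrix.mul_assoc]
      have hQ0 : Q ≠ 0 := fun h0 => hD0 (by
        have : P⁻¹ * Q * P = dominantDiagonal J := by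
          rw [hQdef]
          simp only [Matrix.mul_assoc, Matrix.nonsing_inv_mul_cancel_left _ _ hdet,
            Matrix.nonsing_inv_mul _ hdet, Matrix.mul_one]
        rw [← this, h0, Matrix.mul_zero, Matrix.zero_mul])
      refine ⟨hc, hs'.map_conj_eq hc, ?_⟩
      simpa only [← norm_toComplex, toComplex_pow] using hs'.tendsto_div hQ0
  have hQV : ∀ X : Matrix (Fin n) (Fin d) ℂ,
      dominantColumns P J * (dominantRows P⁻¹ J * X) = Q * X := fun X => by
    rw [← Matrix.mul_assoc, dominantColumns_mul_dominantRows]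
  refine ⟨fun k Z => dominantRows P⁻¹ J * toComplex (normalizeF (nodeRep A W Z k)),
    fun k => measurable_mul_toComplex_normalizeF_nodeRep A W k _, fun k Z i j => ?_, ?_⟩
  · change ((dominantColumns P J * (dominantRows P⁻¹ J *
      toComplex (normalizeF (nodeRep A W Z k)))) i j).im = 0
    have hent : ∀ a b, (starRingEnd ℂ) (Q a b) = Q a b := fun a b => congrFun₂ hreal a b
    rw [hQV, ← Complex.conj_eq_iff_im, Matrix.mul_apply, map_sum]
    refine Finset.sum_congr rfl fun x _ => ?_
    rw [map_mul, hent]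
    simp [toComplex]
  · simp only [hQV]
    exact tendstoInMeasure_normalizeF_sub_mul hm hQA W hlim

/-! ### A simple dominant eigenvalue -/

theorem Matrix.rank_vecMulVec_eq_one {n d : ℕ} {u : Fin n → ℝ} {v : Fin d → ℝ} (hu : u ≠ 0)
    (hv : v ≠ 0) : (Matrix.vecMulVec u v).rank = 1 := by
  refine le_antisymm (Matrix.rank_vecMulVec_le u v) (Nat.one_le_iff_ne_zero.mpr fun h => ?_)
  have h0 : LinearMap.range (Matrix.vecMulVec u v).mulVecLin = ⊥ := Submodule.finrank_eq_zero.mp h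
  obtain ⟨i, hi⟩ := Function.ne_iff.mp hu
  obtain ⟨j, hj⟩ := Function.ne_iff.mp hv
  have h1 : (Matrix.vecMulVec u v).mulVecLin (Pi.single j 1) = 0 := by
    rw [LinearMap.range_eq_bot.mp h0, LinearMap.zero_apply]
  have h2 := congrFun h1 i
  rw [Matrix.mulVecLin_apply, Matrix.mulVec_single_one] at h2
  simp only [Matrix.col_apply, Matrix.vecMulVec_apply, Pi.zero_apply] at h2
  exact mul_ne_zero hi hj h2

/-- An eigenvector for an eigenvalue of algebraic multiplicity one spans the eigenspace and pairs
nontrivially with a left eigenvector. -/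
theorem Module.End.exists_dual_of_rootMultiplicity_eq_one {K V : Type*} [Field K] [AddCommGroup V]
    [Module K V] [FiniteDimensional K V] {f : Module.End K V} {μ : K}
    (hμ : f.charpoly.rootMultiplicity μ = 1) {u : V} (hu : u ≠ 0) (hfu : f u = μ • u) :
    (∀ x, f x = μ • x → ∃ c : K, c • u = x) ∧
      ∃ φ : Module.Dual K V, φ u = 1 ∧ ∀ x, φ (f x) = μ * φ x := by
  set g : Module.End K V := f - μ • 1 with hg
  have hgx : ∀ x, g x = f x - μ • x := fun x => by simp [hg]
  have hmem : ∀ (k : ℕ) (x : V), (g ^ k) x = 0 → x ∈ f.maxGenEigenspace μ := fun k x hx =>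
    (Module.End.mem_maxGenEigenspace f μ x).mpr ⟨k, hx⟩
  have hgu : g u = 0 := by rw [hgx, hfu, sub_self]
  have hspan : ∀ x ∈ f.maxGenEigenspace μ, ∃ c : K, c • u = x := fun x hx => by
    have hr := LinearMap.finrank_maxGenEigenspace_eq f μ
    rw [hμ, finrank_eq_one_iff_of_nonzero' (⟨u, hmem 1 u (by simpa using hgu)⟩ :
      f.maxGenEigenspace μ) (by simpa using hu)] at hr
    obtain ⟨c, hc⟩ := hr ⟨x, hx⟩
    exact ⟨c, congrArg Subtype.val hc⟩
  refine ⟨fun x hx => hspan x (hmem 1 x (by simp [hgx, hx])), ?_⟩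
  -- If `u = g y`, then `y` is a generalized eigenvector, hence a multiple of `u`, and `g y = 0`. A
  -- functional that kills the range of `g` but not `u` is then the left eigenvector.
  have hnot : u ∉ LinearMap.range g := by
    rintro ⟨y, hy⟩
    obtain ⟨c, rfl⟩ := hspan y (hmem 2 y (by
      rw [pow_two, Module.End.mul_apply, hy, hgu]))
    rw [map_smul, hgu, smul_zero] at hy
    exact hu hy.symm
  obtain ⟨φ, hφu, hφ⟩ := Submodule.exists_dual_map_eq_bot_of_notMem hnot inferInstance
  refine ⟨(φ u)⁻¹ • φ, by simp [hφu], fun x => ?_⟩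
  have hx : φ (g x) = 0 := by
    have : φ (g x) ∈ (LinearMap.range g).map φ := ⟨g x, ⟨x, rfl⟩, rfl⟩
    rwa [hφ, Submodule.mem_bot] at this
  rw [hgx, map_sub, map_smul, sub_eq_zero] at hx
  simp only [LinearMap.smul_apply, hx, smul_eq_mul]
  ring

section dominant

variable {n d : ℕ} {A : Matrix (Fin n) (Fin n) ℝ} {lam : ℂ}

theorem toComplex_charpoly (A : Matrix (Fin n) (Fin n) ℝ) :
    (toComplex A).charpoly = A.charpoly.map (algebraMap ℝ ℂ) :=
  Matrix.charpoly_map A (algebraMap ℝ ℂ)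

theorem isRoot_toComplex_charpoly_iff {z : ℂ} :
    (toComplex A).charpoly.IsRoot z ↔ Polynomial.aeval z A.charpoly = 0 := by
  rw [toComplex_charpoly, Polynomial.IsRoot, Polynomial.eval_map_algebraMap]

theorem mem_roots_toComplex_charpoly_iff {z : ℂ} :
    z ∈ (toComplex A).charpoly.roots ↔ Polynomial.aeval z A.charpoly = 0 := by
  rw [Polynomial.mem_roots (toComplex A).charpoly_monic.ne_zero, isRoot_toComplex_charpoly_iff]

/-- The conjugate is a root of the same modulus, so strict dominance forces it to be `lam` itself.
-/
theorem IsDominantEigenvalue.ofReal_re (h : IsDominantEigenvalue A lam) : (lam.re : ℂ) = lam := by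
  obtain ⟨s, hs, hlt⟩ := h
  rw [← Complex.conj_eq_iff_re]
  by_contra hne
  have h1 : Polynomial.aeval lam A.charpoly = 0 :=
    mem_roots_toComplex_charpoly_iff.mp (hs ▸ Multiset.mem_cons_self _ _)
  have h2 : (starRingEnd ℂ) lam ∈ (toComplex A).charpoly.roots :=
    mem_roots_toComplex_charpoly_iff.mpr (by rw [Polynomial.aeval_conj, h1, map_zero])
  rw [hs, Multiset.mem_cons] at h2
  have h3 := hlt _ (h2.resolve_left hne)
  rw [RCLike.norm_conj] at h3
  exact lt_irrefl _ h3

theorem IsDominantEigenvalue.exists_isRealEigenvector (h : IsDominantEigenvalue A lam) :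
    ∃ u, IsRealEigenvector A lam u := by
  have hre := h.ofReal_re
  obtain ⟨s, hs, -⟩ := h
  have h1 : Polynomial.aeval lam A.charpoly = 0 :=
    mem_roots_toComplex_charpoly_iff.mp (hs ▸ Multiset.mem_cons_self _ _)
  have h2 : A.charpoly.IsRoot lam.re := by
    rw [← hre, ← Complex.coe_algebraMap, Polynomial.aeval_algebraMap_apply] at h1
    rw [Polynomial.IsRoot, ← Polynomial.coe_aeval_eq_eval]
    exact (map_eq_zero_iff _ (algebraMap ℝ ℂ).injective).mp h1
  rw [← Matrix.mem_spectrum_iff_isRoot_charpoly, ← Matrix.spectrum_toLin',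
    ← Module.End.hasEigenvalue_iff_mem_spectrum] at h2
  obtain ⟨u, hu⟩ := h2.exists_hasEigenvector
  refine ⟨u, hu.2, ?_⟩
  have h3 : A.mulVec u = lam.re • u := hu.apply_eq_smul
  funext i
  have h4 := RingHom.map_mulVec (algebraMap ℝ ℂ) A u i
  rw [h3] at h4
  refine Eq.trans h4.symm ?_
  rw [Pi.smul_apply, Pi.smul_apply, smul_eq_mul, smul_eq_mul, map_mul, Complex.coe_algebraMap, hre]

theorem exists_gap_of_forall_norm_lt {s : Multiset ℂ} {ρ : ℝ} (hρ : 0 < ρ)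
    (h : ∀ z ∈ s, ‖z‖ < ρ) : ∃ r, 0 < r ∧ r < ρ ∧ ∀ z ∈ s, ‖z‖ < r := by
  classical
  obtain ⟨r, h1, h2, h3⟩ : ∃ r, (∀ z ∈ s.toFinset, ‖z‖ < r) ∧ 0 < r ∧ r < ρ :=
    (((s.toFinset.eventually_all).mpr fun z hz => mem_of_superset
      (Ioo_mem_nhdsLT (h z (Multiset.mem_toFinset.mp hz))) fun _ h => h.1).and
      (Ioo_mem_nhdsLT hρ)).exists
  exact ⟨r, h2, h3, fun z hz => h1 z (Multiset.mem_toFinset.mpr hz)⟩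

/-- The spectral projection of the dominant eigenvalue has the form `u wᵀ`. -/
theorem IsDominantEigenvalue.exists_vecMulVec (h : IsDominantEigenvalue A lam) {u : Fin n → ℝ}
    (hu : IsRealEigenvector A lam u) :
    ∃ w : Fin n → ℂ, Commute (Matrix.vecMulVec (fun i => (u i : ℂ)) w) (toComplex A) ∧
      Tendsto (fun k => ‖toComplex A ^ k * (1 - Matrix.vecMulVec (fun i => (u i : ℂ)) w)‖
        / ‖A ^ k‖) atTop (𝓝 0) := by
  obtain ⟨s, hs, hlt⟩ := h
  obtain ⟨hu0, hAu⟩ := hu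
  set U : Fin n → ℂ := fun i => (u i : ℂ) with hU
  have hU0 : U ≠ 0 := fun h0 => hu0 (funext fun i => by simpa [hU] using congrFun h0 i)
  have hmult : (Matrix.toLin' (toComplex A)).charpoly.rootMultiplicity lam = 1 := by
    classical
    rw [Matrix.charpoly_toLin', ← Polynomial.count_roots, hs, Multiset.count_cons_self,
      Multiset.count_eq_zero_of_notMem fun hmem => lt_irrefl _ (hlt _ hmem)]
  obtain ⟨hspan, φ, hφU, hφA⟩ :=
    Module.End.exists_dual_of_rootMultiplicity_eq_one hmult hU0 (by rwa [Matrix.toLin'_apply])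
  simp only [Matrix.toLin'_apply] at hspan hφA
  set w : Fin n → ℂ := fun i => φ (Pi.single i 1) with hw
  have hφ : ∀ x, w ⬝ᵥ x = φ x := fun x => by
    conv_rhs => rw [pi_eq_sum_univ' x, map_sum]
    simp only [dotProduct, hw, map_smul, smul_eq_mul, mul_comm]
  set Q := Matrix.vecMulVec U w with hQdef
  have hAQ : toComplex A * Q = lam • Q := by
    rw [hQdef, Matrix.mul_vecMulVec, hAu, Matrix.smul_vecMulVec]
  have hwA : Matrix.vecMul w (toComplex A) = lam • w := by
    refine dotProduct_eq _ _ fun x => ?_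
    rw [← Matrix.dotProduct_mulVec, hφ, hφA, smul_dotProduct, hφ, smul_eq_mul]
  have hQA : Q * toComplex A = lam • Q := by
    rw [hQdef, Matrix.vecMulVec_mul, hwA, Matrix.vecMulVec_smul]
  have hcomm : Commute Q (toComplex A) := hQA.trans hAQ.symm
  have hQi : IsIdempotentElem Q := by
    rw [IsIdempotentElem, hQdef, Matrix.vecMulVec_mul_vecMulVec, hφ, hφU, one_smul]
  refine ⟨w, hcomm, ?_⟩
  -- No modulus lies strictly below zero, so `lam` is the only root; then `n = 1` and `Q = 1`.
  by_cases hlam : lam = 0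
  · have hs0 : s = 0 := Multiset.eq_zero_of_forall_notMem fun z hz => by
      have := hlt z hz
      rw [hlam, norm_zero] at this
      exact absurd this (norm_nonneg z).not_gt
    have hn : n = 1 := by
      have h1 := (IsAlgClosed.splits (toComplex A).charpoly).natDegree_eq_card_roots
      rw [hs, hs0, Matrix.charpoly_natDegree_eq_dim] at h1
      simpa using h1
    subst hn
    have hQ1 : Q = 1 := by
      ext i j
      rw [Subsingleton.elim i 0, Subsingleton.elim j 0, hQdef, Matrix.vecMulVec_apply,
        Matrix.one_apply_eq, ← hφU, ← hφ]
      simp [dotProduct, mul_comm]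
    rw [← hQdef, hQ1]
    simp
  · have hρ : 0 < ‖lam‖ := norm_pos_iff.mpr hlam
    obtain ⟨r, hr0, hrl, hsr⟩ := exists_gap_of_forall_norm_lt hρ hlt
    set M := toComplex A * (1 - Q) with hM
    have hMx : ∀ x, M.mulVec x = (toComplex A).mulVec x - (lam * φ x) • U := fun x => by
      rw [hM, Matrix.mul_sub, Matrix.mul_one, hAQ, Matrix.sub_mulVec, Matrix.smul_mulVec, hQdef,
        Matrix.vecMulVec_mulVec, hφ, mul_smul]
      simp
    -- Applying `φ` to `M x = z x` gives `z * φ x = 0`. If `φ x = 0`, then `x` is an eigenvector of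
    -- `A`, and `z ≠ lam` because `φ` is nonzero on the span of `u`.
    have hspec : ∀ z ∈ spectrum ℂ M, ‖z‖ < r := fun z hz => by
      rw [← Matrix.spectrum_toLin', ← Module.End.hasEigenvalue_iff_mem_spectrum] at hz
      obtain ⟨x, hx⟩ := hz.exists_hasEigenvector
      have hx1 : (toComplex A).mulVec x - (lam * φ x) • U = z • x := by
        rw [← hMx]
        exact hx.apply_eq_smul
      have hx2 : z * φ x = 0 := by
        have := congrArg φ hx1
        rw [map_sub, hφA, map_smul, map_smul, hφU, smul_eq_mul, smul_eq_mul, mul_one,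
          sub_self] at this
        exact this.symm
      rcases mul_eq_zero.mp hx2 with hz0 | hφx
      · rwa [hz0, norm_zero]
      · rw [hφx, mul_zero, zero_smul, sub_zero] at hx1
        have hzroot : z ∈ (toComplex A).charpoly.roots := by
          rw [Polynomial.mem_roots (toComplex A).charpoly_monic.ne_zero,
            ← Matrix.mem_spectrum_iff_isRoot_charpoly, ← Matrix.spectrum_toLin',
            ← Module.End.hasEigenvalue_iff_mem_spectrum]
          exact Module.End.hasEigenvalue_of_hasEigenvector
            ⟨Module.End.mem_eigenspace_iff.mpr hx1, hx.2⟩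
        rw [hs, Multiset.mem_cons] at hzroot
        rcases hzroot with rfl | hz
        · obtain ⟨c, rfl⟩ := hspan x hx1
          rw [map_smul, hφU, smul_eq_mul, mul_one] at hφx
          exact absurd (by rw [hφx, zero_smul]) hx.2
        · exact hsr z hz
    have hpowQ : ∀ k : ℕ, toComplex A ^ k * Q = lam ^ k • Q := fun k => by
      induction k with
      | zero => simp
      | succ k ih => rw [pow_succ, Matrix.mul_assoc, hAQ, Matrix.mul_smul, ih, smul_smul, pow_succ']
    have hsplit : IsDominatedSplitting (toComplex A) Q := by
      refine ⟨fun k => (lam ^ k)⁻¹ • Q, Eventually.of_forall fun k => ?_, ?_⟩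
      · have hk : lam ^ k ≠ 0 := pow_ne_zero k hlam
        rw [Matrix.mul_smul, Matrix.smul_mul, (hcomm.pow_right k).eq, hpowQ, smul_smul,
          inv_mul_cancel₀ hk, one_smul]
        exact ⟨rfl, rfl⟩
      · have hlim := (Matrix.tendsto_frobenius_norm_pow_div_pow M hr0 hspec).mul_const ‖Q‖
        rw [zero_mul] at hlim
        refine squeeze_zero' (Eventually.of_forall fun k => by positivity) ?_ hlim
        filter_upwards [eventually_ne_atTop 0] with k hk
        have hc : Commute (toComplex A) (1 - Q) := (Commute.one_right _).sub_right hcomm.symm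
        rw [← hc.mul_pow_of_isIdempotentElem hQi.one_sub hk,
          @norm_smul _ _ _ _ _ Matrix.frobeniusNormSMulClass, norm_inv, norm_pow, ← mul_assoc,
          ← div_eq_mul_inv]
        gcongr
    have hQ0 : Q ≠ 0 := fun h0 => by
      have h1 : Q.mulVec U = U := by
        rw [hQdef, Matrix.vecMulVec_mulVec, hφ, hφU]
        simp
      rw [h0, Matrix.zero_mulVec] at h1
      exact hU0 h1.symm
    simpa only [← norm_toComplex, toComplex_pow] using hsplit.tendsto_div hQ0

theorem tendstoInMeasure_zero_of_le_add {α : Type*} {_ : MeasurableSpace α} {μ : Measure α}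
    {f g : ℕ → α → ℝ} {c : ℕ → ℝ} (hf : ∀ k x, 0 ≤ f k x) (h : ∀ k x, f k x ≤ g k x + c k)
    (hg : TendstoInMeasure μ g atTop fun _ => 0) (hc : Tendsto c atTop (𝓝 0)) :
    TendstoInMeasure μ f atTop fun _ => 0 := by
  rw [tendstoInMeasure_iff_norm] at hg ⊢
  intro ε hε
  refine tendsto_of_tendsto_of_tendsto_of_le_of_le' tendsto_const_nhds (hg (ε / 2) (half_pos hε))
    (Eventually.of_forall fun _ => zero_le) ?_
  filter_upwards [hc.eventually_lt_const (half_pos hε)] with k hk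
  refine measure_mono fun x hx => ?_
  have hx' : ε ≤ f k x := by simpa [abs_of_nonneg (hf k x)] using hx
  change ε / 2 ≤ ‖g k x - 0‖
  rw [sub_zero]
  refine le_trans ?_ (Real.le_norm_self _)
  linarith [h k x]

/-- The coefficients are the real parts of `wᵀ X̂^(k)`. Since `u` and `X̂^(k)` are real, taking real
parts does not increase the error. -/
theorem IsDominantEigenvalue.exists_rankCollapseInProbability (hd : 0 < d)
    (h : IsDominantEigenvalue A lam) (W : ℕ → Matrix (Fin d) (Fin d) ℝ) {m : ℝ} (hm : 0 < m)
    {u : Fin n → ℝ} (hu : IsRealEigenvector A lam u) :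
    ∃ v : ℕ → Matrix (Fin n) (Fin d) ℝ → Fin d → ℝ, (∀ k, Measurable (v k)) ∧
      RankCollapseInProbability (uniformBox n d m) (fun k Z => nodeRep A W Z k)
        (fun k Z => Matrix.vecMulVec u (v k Z)) := by
  classical
  obtain ⟨w, hcomm, hlim⟩ := h.exists_vecMulVec hu
  set Q := Matrix.vecMulVec (fun i => (u i : ℂ)) w with hQ
  let t : ℕ → Matrix (Fin n) (Fin d) ℝ → Fin d → ℝ := fun k Z j =>
    ((Matrix.replicateRow Unit w * toComplex (normalizeF (nodeRep A W Z k))) () j).re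
  have htm : ∀ k, Measurable (t k) := fun k => measurable_pi_iff.mpr fun j =>
    Complex.measurable_re.comp ((measurable_matrix_entry () j).comp
      (measurable_mul_toComplex_normalizeF_nodeRep A W k _))
  -- Substituted where the coefficient vector vanishes: rank one is required everywhere, and a
  -- nonzero vector tending to zero costs only a vanishing error.
  let c : ℕ → Fin d → ℝ := fun k _ => 1 / ((k : ℝ) + 1)
  have hc0 : ∀ k, c k ≠ 0 := fun k h0 => by
    have := congrFun h0 ⟨0, hd⟩
    have hpos : 0 < 1 / ((k : ℝ) + 1) := by positivity
    exact hpos.ne' this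
  have hle : ∀ k Z, ‖normalizeF (nodeRep A W Z k) - Matrix.vecMulVec u (t k Z)‖
      ≤ ‖toComplex (normalizeF (nodeRep A W Z k))
        - Q * toComplex (normalizeF (nodeRep A W Z k))‖ := fun k Z => by
    refine Matrix.frobenius_norm_mono _ _ fun i j => ?_
    set X := normalizeF (nodeRep A W Z k)
    have e : (X - Matrix.vecMulVec u (t k Z)) i j = ((toComplex X - Q * toComplex X) i j).re := by
      rw [hQ, Matrix.vecMulVec_mul]
      simp [t, toComplex, Matrix.vecMulVec_apply, Matrix.mul_apply, Matrix.vecMul, dotProduct, X]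
    rw [e, Real.norm_eq_abs]
    exact Complex.abs_re_le_norm _
  refine ⟨fun k Z => if t k Z = 0 then c k else t k Z, fun k =>
    Measurable.ite (htm k (measurableSet_singleton 0)) measurable_const (htm k), fun k Z => ?_, ?_⟩
  · refine Matrix.rank_vecMulVec_eq_one hu.1 ?_
    dsimp only
    split_ifs with h0
    · exact hc0 k
    · exact h0
  · refine tendstoInMeasure_zero_of_le_add (c := fun k : ℕ => 1 / ((k : ℝ) + 1) *
      ‖Matrix.vecMulVec u (fun _ : Fin d => (1 : ℝ))‖) (fun k Z => norm_nonneg _) (fun k Z => ?_)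
      (tendstoInMeasure_normalizeF_sub_mul hm hcomm W hlim) ?_
    · dsimp only
      split_ifs with h0
      · have hck : Matrix.vecMulVec u (c k)
            = (1 / ((k : ℝ) + 1)) • Matrix.vecMulVec u (fun _ : Fin d => (1 : ℝ)) := by
          ext i j
          simp [c, Matrix.vecMulVec_apply, mul_comm]
        have hz : Matrix.vecMulVec u (t k Z) = 0 := by
          ext i j
          simp [h0, Matrix.vecMulVec_apply]
        have h1 := hle k Z
        rw [hz, sub_zero] at h1
        refine (norm_sub_le _ _).trans (add_le_add h1 ?_)
        rw [hck, @norm_smul _ _ _ _ _ Matrix.frobeniusNormSMulClass, Real.norm_of_nonneg]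
        positivity
      · exact (hle k Z).trans (le_add_of_nonneg_right (by positivity))
    · simpa using (tendsto_one_div_add_atTop_nhds_zero_nat (𝕜 := ℝ)).mul_const
        ‖Matrix.vecMulVec u (fun _ : Fin d => (1 : ℝ))‖

end dominant

theorem mainTheorem1 {n d : ℕ} (hd : 0 < d) (A : Matrix (Fin n) (Fin n) ℝ)
    (W : ℕ → Matrix (Fin d) (Fin d) ℝ) (m : ℝ) (hm : 0 < m) :
    -- the normalization is defined almost surely, except where `A^k` or `W^(1) ⋯ W^(k)` is zero
    (∀ k : ℕ, A ^ k ≠ 0 → ((List.range k).map (fun i => W (i + 1))).prod ≠ 0 →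
      ∀ᵐ Z ∂(uniformBox n d m), nodeRep A W Z k ≠ 0) ∧
    -- a unique eigenvalue of maximal modulus: rank collapse in probability
    (∀ lam : ℂ, IsDominantEigenvalue A lam →
      (∃ u : Fin n → ℝ, IsRealEigenvector A lam u) ∧
      ∀ u : Fin n → ℝ, IsRealEigenvector A lam u →
        ∃ v : ℕ → Matrix (Fin n) (Fin d) ℝ → Fin d → ℝ,
          (∀ k, Measurable (v k)) ∧
          RankCollapseInProbability (uniformBox n d m) (fun k Z => nodeRep A W Z k)
            (fun k Z => Matrix.vecMulVec u (v k Z))) ∧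
    -- an arbitrary matrix: convergence in probability to the span of the generalized eigenvectors
    (∀ P J : Matrix (Fin n) (Fin n) ℂ, IsJordanDecomposition A P J →
      ∃ V : ℕ → Matrix (Fin n) (Fin d) ℝ → Matrix (DominantIndex J) (Fin d) ℂ,
        (∀ k, Measurable (V k)) ∧
        (∀ k Z i j, ((dominantColumns P J * V k Z) i j).im = 0) ∧
        TendstoInMeasure (uniformBox n d m)
          (fun k Z => ‖toComplex (normalizeF (nodeRep A W Z k)) - dominantColumns P J * V k Z‖)
          atTop (fun _ => (0 : ℝ))) :=
  ⟨fun k hA hB => ae_uniformBox_nodeRep_ne_zero hm A W k hA hB,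
    fun _ h => ⟨h.exists_isRealEigenvector,
      fun _ hu => h.exists_rankCollapseInProbability hd W hm hu⟩,
    fun _ _ h => exists_tendstoInMeasure_dominantColumns W hm h⟩
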